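/- A one-dimensional polygonal curve is given by a non-empty sequence of real numbers, its vertices $p_1,\dots,p_m$, and is viewed as a continuous function $P:[0,1]\to\mathbb{R}$ that passes through $p_1,\dots,p_m$ in this order and interpolates linearly between consecutive vertices. The Fréchet distance of two such curves is $d_F(P,Q)=\min_{f,g}\max_{t\in[0,1]}|P(f(t))-Q(g(t))|$, where $f,g$ range over the monotone surjective functions $[0,1]\to[0,1]$. A $\delta$-straightening of $Q$ is a curve $Q'$ whose vertex sequence is a subsequence $Q(t_1),\dots,Q(t_\ell)$, $t_1<\dots<t_\ell$, of the vertices of $Q$ that contains the first and the last vertex of $Q$, such that - $Q'$ is non-degenerate: no vertex of $Q'$ lies on the line segment between its predecessor and its successor; - $d_F\big(\overline{Q(t_i)Q(t_{i+1})},\,Q[t_i,t_{i+1}]\big)\le\delta$ for all $1\le i<\ell$, where $\overline{ab}$ is the directed segment from $a$ to $b$ and $Q[s,t]$ is the subcurve of $Q$ between the parameters $s$ and $t$; - $Q(t)\in\overline{Q(t_i)Q(t_{i+1})}$ for all $1\le i<\ell$ and all $t\in[t_i,t_{i+1}]$. A $\delta$-visiting order of a curve with vertices $u_1,\dots,u_\ell$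 on a curve with vertices $v_1,\dots,v_m$ is a sequence of indices $i_1\le\dots\le i_\ell$ in $\{1,\dots,m\}$ with $|u_j-v_{i_j}|\le\delta$ for all $j$. **Lemma.** Let $P$ and $Q$ be one-dimensional polygonal curves and $\delta$ a real number with $d_F(Q,P)\le\delta$. Then there exists a $\delta$-straightening $Q'$ of $Q$ such that 1. there exists an $11\delta$-visiting order of $Q'$ on $P$, and 2. $d_F(Q',P)\le\delta$. -/

import Mathlib

open scoped unitInterval

noncomputable section

/-- The reparametrizations of `[0,1]`: monotone and surjective functions from `[0,1]` to `[0,1]`. -/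
def Reparam : Type := {f : I → I // Monotone f ∧ Function.Surjective f}

/-- The (continuous) Fréchet distance of two one-dimensional curves `P, Q : [0,1] → ℝ`. The curves
are continuous, so the inner supremum is that of a bounded function. -/
def frechetDist (P Q : C(I, ℝ)) : ℝ :=
  ⨅ φ : Reparam × Reparam, ⨆ t : I, |P (φ.1.1 t) - Q (φ.2.1 t)|

/-- The directed line segment from `a` to `b`, as a curve. -/
def segmentCurve (a b : ℝ) : C(I, ℝ) where
  toFun s := (1 - (s : ℝ)) * a + s * b

/-- The subcurve `P[a,b]`, reparametrized affinely over `[0,1]`. -/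
def subcurve (P : C(I, ℝ)) (a b : I) : C(I, ℝ) where
  toFun s := P ⟨(1 - (s : ℝ)) * a + s * b,
    (convex_Icc (0 : ℝ) 1) a.2 b.2 (sub_nonneg.2 s.2.2) s.2.1 (sub_add_cancel _ _)⟩

/-- A one-dimensional polygonal curve, given by its sequence of `numEdges + 1 ≥ 1` vertices.
Degenerate vertices and repeated points are allowed. -/
structure PolygonalCurve where
  numEdges : ℕ
  vertex : Fin (numEdges + 1) → ℝ

namespace PolygonalCurve

/-- The polygonal curve as a continuous function on `[0,1]`, with the standard parametrization: the
edge from `vertex i` to `vertex (i+1)` is traversed at constant speed while the parameter runs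
through `[i / numEdges, (i+1) / numEdges]`. During that time `numEdges * t - i` runs through
`[0,1]`; it is clamped to `0` before and to `1` after. -/
def curve (P : PolygonalCurve) : C(I, ℝ) where
  toFun t := P.vertex 0 + ∑ i : Fin P.numEdges,
    (P.vertex i.succ - P.vertex i.castSucc) * max 0 (min 1 ((P.numEdges : ℝ) * t - (i : ℕ)))

/-- The parameter `i / numEdges` in `[0,1]` at which the curve passes through `vertex i`. -/
def param (P : PolygonalCurve) (i : Fin (P.numEdges + 1)) : I :=
  ⟨((i : ℕ) : ℝ) / P.numEdges, by positivity,
    div_le_one_of_le₀ (by exact_mod_cast Nat.le_of_lt_succ i.2) (by positivity)⟩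

/-- No vertex lies on the line segment spanned by its predecessor and its successor. -/
def Nondegenerate (P : PolygonalCurve) : Prop :=
  ∀ i j k : Fin (P.numEdges + 1), (i : ℕ) + 1 = j → (j : ℕ) + 1 = k →
    P.vertex j ∉ segment ℝ (P.vertex i) (P.vertex k)

/-- `P'` is a `δ`-simplification of `P`, formed from the subsequence of the vertices of `P` with
the indices `t 0 < t 1 < ⋯`, which contains the first and the last vertex of `P`. -/
structure IsSimplification (δ : ℝ) (P P' : PolygonalCurve)
    (t : Fin (P'.numEdges + 1) → Fin (P.numEdges + 1)) : Prop where
  strictMono : StrictMono t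
  first : t 0 = 0
  last : t (Fin.last _) = Fin.last _
  vertex_eq : ∀ i, P'.vertex i = P.vertex (t i)
  nondegenerate : P'.Nondegenerate
  locality : ∀ i : Fin P'.numEdges,
    frechetDist (segmentCurve (P'.vertex i.castSucc) (P'.vertex i.succ))
      (subcurve P.curve (P.param (t i.castSucc)) (P.param (t i.succ))) ≤ δ

/-- For every edge of `P'`, the subcurve of `P` between the endpoints of that edge stays within the
edge (as a subset of `ℝ`). -/
def IsEdgeRangePreserving (P P' : PolygonalCurve)
    (t : Fin (P'.numEdges + 1) → Fin (P.numEdges + 1)) : Prop :=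
  ∀ i : Fin P'.numEdges, ∀ s ∈ Set.Icc (P.param (t i.castSucc)) (P.param (t i.succ)),
    P.curve s ∈ segment ℝ (P'.vertex i.castSucc) (P'.vertex i.succ)

/-- `P'` is a `δ`-straightening of `P`: an edge-range-preserving `δ`-simplification. -/
def IsStraightening (δ : ℝ) (P P' : PolygonalCurve) : Prop :=
  ∃ t : Fin (P'.numEdges + 1) → Fin (P.numEdges + 1),
    IsSimplification δ P P' t ∧ IsEdgeRangePreserving P P' t

/-- `κ` is a `δ`-visiting order of `Q` on `P`. -/
def IsVisitingOrder (δ : ℝ) (Q P : PolygonalCurve)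
    (κ : Fin (Q.numEdges + 1) → Fin (P.numEdges + 1)) : Prop :=
  Monotone κ ∧ ∀ j, |Q.vertex j - P.vertex (κ j)| ≤ δ

end PolygonalCurve

end

/-!
Match `Q` with `P` to within some `ε > δ`. Between two parameters, `Q` may be replaced by a segment
as soon as it stays within the range of that segment and neither `Q` nor the matched part of `P`
ever runs against its direction by more than `2 * ε`: a monotone curve within `ε` of `P` then lies
between the running maximum of `P` minus `ε` and the running minimum of `P` plus `ε`. Every edge of
`Q` is such a shortcut, so there is a chain of shortcuts which no shortcut bypasses; its breakpoints
are the vertices of the straightening. Consecutive shortcuts of this chain alternate in direction.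

At a breakpoint between two edges longer than `2 * ε`, a vertex of `P` in the matched parts is
extremal enough to be visited. An edge of length at most `2 * ε` that is no longer than its two
neighbours cannot be merged with them, so `P` backtracks by more than `2 * ε` there and has a vertex
close to each end of that edge. Any other short edge leads, through shorter and shorter edges and
hence with oscillation at most `2 * ε`, to one of these or to an end of the curve. Taking the first
suitable vertices of `P` makes the visiting order monotone.

Finally, there are only finitely many subsequences and visiting orders, so one of them works for all
`ε > δ`, and therefore for `δ`.
-/

open Set

/-! ### Reparametrizations and running extrema -/

theorem frechetDist_le {P Q : C(I, ℝ)} {δ : ℝ} (φ ψ : Reparam)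
    (h : ∀ t, |P (φ.1 t) - Q (ψ.1 t)| ≤ δ) : frechetDist P Q ≤ δ :=
  (ciInf_le ⟨0, forall_mem_range.2 fun _ ↦ Real.iSup_nonneg fun _ ↦ abs_nonneg _⟩
    (φ, ψ)).trans (ciSup_le h)

namespace Reparam

/-- The trivial reparametrization. -/
protected def refl : Reparam := ⟨id, monotone_id, Function.surjective_id⟩

theorem continuous (φ : Reparam) : Continuous φ.1 :=
  φ.2.1.continuous_of_surjective φ.2.2

theorem map_zero (φ : Reparam) : φ.1 0 = 0 := by
  obtain ⟨x, hx⟩ := φ.2.2 0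
  exact le_antisymm ((φ.2.1 unitInterval.nonneg').trans_eq hx) unitInterval.nonneg'

theorem map_one (φ : Reparam) : φ.1 1 = 1 := by
  obtain ⟨x, hx⟩ := φ.2.2 1
  exact le_antisymm unitInterval.le_one' (hx.symm.trans_le (φ.2.1 unitInterval.le_one'))

open Classical in
/-- A section of the reparametrization `φ`, chosen so that it fixes the endpoints of `[0,1]`. -/
noncomputable def lift (φ : Reparam) : I → I :=
  Function.update (Function.update (Function.surjInv φ.2.2) 0 0) 1 1

@[simp]
theorem lift_zero (φ : Reparam) : φ.lift 0 = 0 := by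
  simp [lift]

@[simp]
theorem lift_one (φ : Reparam) : φ.lift 1 = 1 := by
  simp [lift]

@[simp]
theorem apply_lift (φ : Reparam) (t : I) : φ.1 (φ.lift t) = t := by
  rcases eq_or_ne t 1 with rfl | ht₁
  · rw [lift_one, map_one]
  rcases eq_or_ne t 0 with rfl | ht₀
  · rw [lift_zero, map_zero]
  · rw [lift, Function.update_of_ne ht₁, Function.update_of_ne ht₀]
    exact Function.surjInv_eq φ.2.2 t

theorem lift_strictMono (φ : Reparam) : StrictMono φ.lift := fun s t hst ↦
  φ.2.1.reflect_lt (by rwa [apply_lift, apply_lift])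

theorem exists_coe_eq {Φ : I → ℝ} (hc : Continuous Φ) (hm : Monotone Φ) (h₀ : Φ 0 = 0)
    (h₁ : Φ 1 = 1) : ∃ φ : Reparam, ∀ s, (φ.1 s : ℝ) = Φ s := by
  have hmem (s : I) : Φ s ∈ I :=
    ⟨h₀.symm.trans_le (hm unitInterval.nonneg'), (hm unitInterval.le_one').trans_eq h₁⟩
  refine ⟨⟨fun s ↦ ⟨Φ s, hmem s⟩, hm, fun t ↦ ?_⟩, fun _ ↦ rfl⟩
  obtain ⟨s, hs⟩ := mem_range_of_exists_le_of_exists_ge hc ⟨0, h₀.trans_le t.2.1⟩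
    ⟨1, t.2.2.trans_eq h₁.symm⟩
  exact ⟨s, Subtype.ext hs⟩

end Reparam

theorem exists_reparam_of_frechetDist_lt {P Q : C(I, ℝ)} {δ : ℝ} (h : frechetDist P Q < δ) :
    ∃ φ ψ : Reparam, ∀ t, |P (φ.1 t) - Q (ψ.1 t)| ≤ δ := by
  have : Nonempty (Reparam × Reparam) := ⟨(Reparam.refl, Reparam.refl)⟩
  obtain ⟨⟨φ, ψ⟩, hφψ⟩ := exists_lt_of_ciInf_lt h
  have hbdd : BddAbove (range fun t ↦ |P (φ.1 t) - Q (ψ.1 t)|) :=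
    ⟨‖P‖ + ‖Q‖, forall_mem_range.2 fun t ↦
      (abs_sub _ _).trans (add_le_add (P.norm_coe_le_norm _) (Q.norm_coe_le_norm _))⟩
  exact ⟨φ, ψ, fun t ↦ (le_ciSup hbdd t).trans hφψ.le⟩

section RunningExtrema

variable {τ : Type*} [LinearOrder τ] [TopologicalSpace τ] [OrderClosedTopology τ] [CompactSpace τ]
  {c : τ → ℝ}

theorem exists_runningMax (hc : Continuous c) :
    ∃ M : τ → ℝ, Continuous M ∧ Monotone M ∧ (∀ s, c s ≤ M s) ∧ ∀ s, ∃ u ≤ s, M s = c u := by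
  let M (s : τ) : ℝ := sSup ((fun u ↦ c (s ⊓ u)) '' univ)
  have hM : Continuous M := isCompact_univ.continuous_sSup (by fun_prop)
  have hle {s u : τ} (hu : u ≤ s) : c u ≤ M s := by
    refine le_csSup (isCompact_univ.image (by fun_prop)).bddAbove ⟨u, mem_univ u, ?_⟩
    simp only [inf_eq_right.2 hu]
  have hmem (s : τ) : ∃ u ≤ s, M s = c u := by
    obtain ⟨u, -, hu⟩ := (isCompact_univ (X := τ)).exists_sSup_image_eq ⟨s, mem_univ s⟩
      (f := fun u ↦ c (s ⊓ u)) (by fun_prop)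
    exact ⟨s ⊓ u, inf_le_left, hu⟩
  refine ⟨M, hM, fun s t hst ↦ ?_, fun s ↦ hle le_rfl, hmem⟩
  obtain ⟨u, hus, hu⟩ := hmem s
  exact hu.trans_le (hle (hus.trans hst))

theorem exists_runningMin (hc : Continuous c) :
    ∃ m : τ → ℝ, Continuous m ∧ Monotone m ∧ (∀ s, m s ≤ c s) ∧ ∀ s, ∃ u, s ≤ u ∧ m s = c u := by
  have : CompactSpace τᵒᵈ := ‹CompactSpace τ›
  obtain ⟨M, hM, hmono, hle, hmem⟩ :=
    exists_runningMax (τ := τᵒᵈ) (c := fun s ↦ -c (OrderDual.ofDual s)) hc.neg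
  refine ⟨fun s ↦ -M (OrderDual.toDual s), hM.neg,
    fun s t hst ↦ neg_le_neg (hmono (OrderDual.toDual_le_toDual.2 hst)),
    fun s ↦ neg_le.1 (hle (OrderDual.toDual s)), fun s ↦ ?_⟩
  obtain ⟨u, hus, hu⟩ := hmem (OrderDual.toDual s)
  exact ⟨OrderDual.ofDual u, hus, neg_eq_iff_eq_neg.2 hu⟩

end RunningExtrema

/-! ### Shortcuts -/

theorem abs_neg_sub_neg_le {α : Type*} {q p : α → ℝ} {δ : ℝ} (hqp : ∀ t, |q t - p t| ≤ δ)
    (t : α) : |(-q) t - (-p) t| ≤ δ := by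
  simpa only [Pi.neg_apply, neg_sub_neg, abs_sub_comm] using hqp t

theorem sub_le_sub_add_two_mul {α : Type*} {q p : α → ℝ} {δ : ℝ} (hqp : ∀ t, |q t - p t| ≤ δ)
    (s t : α) : p s - p t ≤ q s - q t + 2 * δ := by
  linarith [(abs_le.1 (hqp s)).1, (abs_le.1 (hqp t)).2]

section Shortcuts

variable {τ ρ : Type*} [LinearOrder τ] [LinearOrder ρ] {δ c : ℝ} {q p r : τ → ℝ} {x y z w : τ}

/-- Along the set `S`, the function `r` never falls by more than `c`. -/
def DropLE (c : ℝ) (r : τ → ℝ) (S : Set τ) : Prop :=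
  ∀ s ∈ S, ∀ t ∈ S, s ≤ t → r s - r t ≤ c

theorem DropLE.union_of_cross (hxy : DropLE c r (Icc x y)) (hzw : DropLE c r (Icc z w))
    (hcross : ∀ s ∈ Icc x z, ∀ t ∈ Icc y w, s ≤ t → r s - r t ≤ c) : DropLE c r (Icc x w) := by
  intro s hs t ht hst
  rcases le_total t y with hty | hyt
  · exact hxy s ⟨hs.1, hst.trans hty⟩ t ⟨ht.1, hty⟩ hst
  rcases le_total z s with hzs | hsz
  · exact hzw s ⟨hzs, hs.2⟩ t ⟨hzs.trans hst, ht.2⟩ hst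
  · exact hcross s ⟨hs.1, hsz⟩ t ⟨hyt, ht.2⟩ hst

/-- Between `x` and `y`, the curve `q` stays in `[q x, q y]` and neither `q` nor the nearby curve
`p` falls by more than `2 * δ`. This is what it takes for the segment from `q x` to `q y` to be
within Fréchet distance `δ` of both curves on `[x, y]`. -/
structure Ascends (δ : ℝ) (q p : τ → ℝ) (x y : τ) : Prop where
  le : x ≤ y
  mapsTo : MapsTo q (Icc x y) (Icc (q x) (q y))
  dropLE_left : DropLE (2 * δ) q (Icc x y)
  dropLE_right : DropLE (2 * δ) p (Icc x y)

/-- The part of `q` between `x` and `y` may be replaced by a segment, ascending or descending. -/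
def Shortcut (δ : ℝ) (q p : τ → ℝ) (x y : τ) : Prop :=
  Ascends δ q p x y ∨ Ascends δ (-q) (-p) x y

namespace Ascends

theorem of_monotoneOn (hδ : 0 ≤ δ) (hqp : ∀ t, |q t - p t| ≤ δ) (hq : MonotoneOn q (Icc x y))
    (hxy : x ≤ y) : Ascends δ q p x y where
  le := hxy
  mapsTo s hs := ⟨hq ⟨le_rfl, hxy⟩ hs hs.1, hq hs ⟨hxy, le_rfl⟩ hs.2⟩
  dropLE_left s hs t ht hst := by linarith [hq hs ht hst]
  dropLE_right s hs t ht hst := by linarith [hq hs ht hst, sub_le_sub_add_two_mul hqp s t]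

theorem of_neg_of_eq (hδ : 0 ≤ δ) (hqp : ∀ t, |q t - p t| ≤ δ) (h : Ascends δ (-q) (-p) x y)
    (heq : q x = q y) : Ascends δ q p x y := by
  have hconst {s : τ} (hs : s ∈ Icc x y) : q s = q x :=
    le_antisymm (neg_le_neg_iff.1 (h.mapsTo hs).1) (heq ▸ neg_le_neg_iff.1 (h.mapsTo hs).2)
  exact of_monotoneOn hδ hqp (fun s hs t ht _ ↦ by rw [hconst hs, hconst ht]) h.le

theorem trans (hδ : 0 ≤ δ) (hqp : ∀ t, |q t - p t| ≤ δ) (h : Ascends δ q p x y)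
    (h' : Ascends δ q p y z) : Ascends δ q p x z where
  le := h.le.trans h'.le
  mapsTo s hs := by
    have hqxy := (h.mapsTo ⟨h.le, le_rfl⟩).1
    have hqyz := (h'.mapsTo ⟨h'.le, le_rfl⟩).1
    rcases le_total s y with hsy | hys
    · exact ⟨(h.mapsTo ⟨hs.1, hsy⟩).1, (h.mapsTo ⟨hs.1, hsy⟩).2.trans hqyz⟩
    · exact ⟨hqxy.trans (h'.mapsTo ⟨hys, hs.2⟩).1, (h'.mapsTo ⟨hys, hs.2⟩).2⟩
  dropLE_left := h.dropLE_left.union_of_cross h'.dropLE_left fun s hs t ht _ ↦ by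
    linarith [(h.mapsTo hs).2, (h'.mapsTo ht).1]
  dropLE_right := h.dropLE_right.union_of_cross h'.dropLE_right fun s hs t ht _ ↦ by
    linarith [(h.mapsTo hs).2, (h'.mapsTo ht).1, sub_le_sub_add_two_mul hqp s t]

theorem comp {f : ρ → τ} {a b : ρ} (h : Ascends δ q p (f a) (f b)) (hf : Monotone f)
    (hab : a ≤ b) : Ascends δ (q ∘ f) (p ∘ f) a b where
  le := hab
  mapsTo _ hs := h.mapsTo ⟨hf hs.1, hf hs.2⟩
  dropLE_left _ hs _ ht hst := h.dropLE_left _ ⟨hf hs.1, hf hs.2⟩ _ ⟨hf ht.1, hf ht.2⟩ (hf hst)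
  dropLE_right _ hs _ ht hst := h.dropLE_right _ ⟨hf hs.1, hf hs.2⟩ _ ⟨hf ht.1, hf ht.2⟩ (hf hst)

theorem self (h : Ascends δ q p x y) : Ascends δ q q x y :=
  ⟨h.le, h.mapsTo, h.dropLE_left, h.dropLE_left⟩

end Ascends

namespace Shortcut

theorem neg (h : Shortcut δ q p x y) : Shortcut δ (-q) (-p) x y := by
  rw [Shortcut, neg_neg, neg_neg]
  exact h.symm

theorem le (h : Shortcut δ q p x y) : x ≤ y :=
  h.elim Ascends.le Ascends.le

theorem comp {f : ρ → τ} {a b : ρ} (h : Shortcut δ q p (f a) (f b)) (hf : Monotone f)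
    (hab : a ≤ b) : Shortcut δ (q ∘ f) (p ∘ f) a b :=
  h.imp (fun h ↦ h.comp hf hab) (fun h ↦ h.comp hf hab)

theorem self (h : Shortcut δ q p x y) : Shortcut δ q q x y :=
  h.imp Ascends.self Ascends.self

theorem mem_uIcc (h : Shortcut δ q p x y) {s : τ} (hs : s ∈ Icc x y) :
    q s ∈ uIcc (q x) (q y) := by
  rw [Set.mem_uIcc]
  exact h.imp (fun h ↦ h.mapsTo hs)
    fun h ↦ ⟨neg_le_neg_iff.1 (h.mapsTo hs).2, neg_le_neg_iff.1 (h.mapsTo hs).1⟩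

end Shortcut

end Shortcuts

section Tracking

variable {δ : ℝ} {q p : I → ℝ} {x y : I}

theorem segmentCurve_apply (a b : ℝ) (s : I) :
    segmentCurve a b s = (1 - (s : ℝ)) * a + s * b :=
  rfl

theorem segmentCurve_neg (a b : ℝ) (s : I) : segmentCurve (-a) (-b) s = -segmentCurve a b s := by
  simp only [segmentCurve_apply]
  ring

theorem segmentCurve_self (a : ℝ) (s : I) : segmentCurve a a s = a := by
  rw [segmentCurve_apply]
  ring

theorem Reparam.exists_segmentCurve_eq {a b : ℝ} (hab : a < b) {Φ : I → ℝ} (hc : Continuous Φ)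
    (hm : Monotone Φ) (h₀ : Φ 0 = a) (h₁ : Φ 1 = b) :
    ∃ φ : Reparam, ∀ s, segmentCurve a b (φ.1 s) = Φ s := by
  have hba : 0 < b - a := sub_pos.2 hab
  obtain ⟨φ, hφ⟩ := Reparam.exists_coe_eq (Φ := fun s ↦ (Φ s - a) / (b - a)) (by fun_prop)
    (fun s t hst ↦ div_le_div_of_nonneg_right (sub_le_sub_right (hm hst) a) hba.le)
    (by simp [h₀]) (by simp [h₁, hba.ne'])
  refine ⟨φ, fun s ↦ ?_⟩
  rw [segmentCurve_apply, hφ]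
  field_simp
  ring

theorem monotone_segmentCurve {lo hi : I → ℝ} (hlo : Monotone lo) (hhi : Monotone hi)
    (hle : ∀ s, lo s ≤ hi s) : Monotone fun s ↦ segmentCurve (lo s) (hi s) s := by
  intro s t hst
  have hst' : (s : ℝ) ≤ t := hst
  simp only [segmentCurve_apply]
  nlinarith [mul_le_mul_of_nonneg_left (hlo hst) (sub_nonneg.2 s.2.2),
    mul_le_mul_of_nonneg_left (hhi hst) s.2.1,
    mul_nonneg (sub_nonneg.2 hst') (sub_nonneg.2 (hle t))]

theorem segmentCurve_mem_Icc {a b : ℝ} (hab : a ≤ b) (s : I) : segmentCurve a b s ∈ Icc a b :=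
  convex_Icc a b ⟨le_rfl, hab⟩ ⟨hab, le_rfl⟩ (sub_nonneg.2 s.2.2) s.2.1 (sub_add_cancel _ _)

-- With `M` the running maximum of `p` and `m` its minimum over the remaining time, every curve
-- between `M - δ` and `m + δ` is within `δ` of `p`; this band is non-empty as `p` drops by at most
-- `2 * δ`.
theorem exists_monotone_abs_sub_le {a b : ℝ} (hab : a ≤ b) (hp : Continuous p)
    (hdrop : DropLE (2 * δ) p univ) (ha : ∀ s, a - δ ≤ p s) (hb : ∀ s, p s ≤ b + δ)
    (ha₀ : p 0 ≤ a + δ) (hb₁ : b - δ ≤ p 1) :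
    ∃ Φ : I → ℝ, Continuous Φ ∧ Monotone Φ ∧ Φ 0 = a ∧ Φ 1 = b ∧ ∀ s, |Φ s - p s| ≤ δ := by
  obtain ⟨M, hM, hM_mono, hpM, hM_mem⟩ := exists_runningMax hp
  obtain ⟨m, hm, hm_mono, hmp, hm_mem⟩ := exists_runningMin hp
  let lo (s : I) : ℝ := max a (M s - δ)
  let hi (s : I) : ℝ := min b (m s + δ)
  have hlo_hi (s : I) : lo s ≤ hi s := by
    obtain ⟨u, hus, hu⟩ := hM_mem s
    obtain ⟨v, hsv, hv⟩ := hm_mem s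
    have huv : p u - p v ≤ 2 * δ := hdrop u trivial v trivial (hus.trans hsv)
    refine max_le (le_min hab ?_) (le_min ?_ ?_) <;> linarith [ha v, hb u]
  have hlo₀ : lo 0 = a := by
    obtain ⟨u, hu₀, hu⟩ := hM_mem 0
    rw [le_antisymm hu₀ unitInterval.nonneg'] at hu
    exact max_eq_left (by linarith)
  have hhi₁ : hi 1 = b := by
    obtain ⟨v, hv₁, hv⟩ := hm_mem 1
    rw [le_antisymm unitInterval.le_one' hv₁] at hv
    exact min_eq_left (by linarith)
  refine ⟨fun s ↦ segmentCurve (lo s) (hi s) s, by simp only [segmentCurve_apply]; fun_prop,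
    monotone_segmentCurve (fun s t hst ↦ max_le_max le_rfl (sub_le_sub_right (hM_mono hst) δ))
      (fun s t hst ↦ min_le_min le_rfl (add_le_add_left (hm_mono hst) δ)) hlo_hi,
    by simp [segmentCurve_apply, hlo₀], by simp [segmentCurve_apply, hhi₁], fun s ↦ ?_⟩
  have hmem := segmentCurve_mem_Icc (hlo_hi s) s
  rw [abs_le]
  constructor
  · linarith [hpM s, (le_max_right _ _).trans hmem.1]
  · linarith [hmp s, hmem.2.trans (min_le_right _ _)]

theorem Ascends.exists_reparam (hqp : ∀ t, |q t - p t| ≤ δ) (hp : Continuous p)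
    (h : Ascends δ q p 0 1) :
    ∃ φ : Reparam, ∀ s, |segmentCurve (q 0) (q 1) (φ.1 s) - p s| ≤ δ := by
  have hI (s : I) : s ∈ Icc (0 : I) 1 := ⟨unitInterval.nonneg', unitInterval.le_one'⟩
  have hq (s : I) : q s ∈ Icc (q 0) (q 1) := h.mapsTo (hI s)
  rcases (hq 1).1.eq_or_lt with heq | hlt
  · refine ⟨Reparam.refl, fun s ↦ ?_⟩
    have hs : q s = q 0 := le_antisymm (heq ▸ (hq s).2) (hq s).1
    rw [← heq, segmentCurve_self, ← hs]
    exact hqp s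
  · have hpq (s : I) : q s - δ ≤ p s ∧ p s ≤ q s + δ :=
      ⟨by linarith [(abs_le.1 (hqp s)).2], by linarith [(abs_le.1 (hqp s)).1]⟩
    obtain ⟨Φ, hΦ, hΦ_mono, hΦ₀, hΦ₁, hΦp⟩ := exists_monotone_abs_sub_le hlt.le hp
      (fun s _ t _ ↦ h.dropLE_right s (hI s) t (hI t)) (fun s ↦ by linarith [hpq s, (hq s).1])
      (fun s ↦ by linarith [hpq s, (hq s).2]) (hpq 0).2 (hpq 1).1
    obtain ⟨φ, hφ⟩ := Reparam.exists_segmentCurve_eq hlt hΦ hΦ_mono hΦ₀ hΦ₁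
    exact ⟨φ, fun s ↦ (hφ s).symm ▸ hΦp s⟩

/-- The affine map of `[0,1]` onto the interval from `x` to `y`, by which `subcurve` precomposes. -/
def affineParam (x y s : I) : I :=
  ⟨segmentCurve x y s,
    (convex_Icc (0 : ℝ) 1) x.2 y.2 (sub_nonneg.2 s.2.2) s.2.1 (sub_add_cancel _ _)⟩

theorem coe_affineParam (x y s : I) : (affineParam x y s : ℝ) = (1 - (s : ℝ)) * x + s * y :=
  rfl

theorem affineParam_zero (x y : I) : affineParam x y 0 = x :=
  Subtype.ext (by simp [coe_affineParam])

theorem affineParam_one (x y : I) : affineParam x y 1 = y :=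
  Subtype.ext (by simp [coe_affineParam])

theorem continuous_affineParam (x y : I) : Continuous (affineParam x y) :=
  (segmentCurve x y).continuous.subtype_mk _

theorem affineParam_monotone (hxy : x ≤ y) : Monotone (affineParam x y) :=
  monotone_segmentCurve monotone_const monotone_const fun _ ↦ hxy

theorem affineParam_mem_Icc (hxy : x ≤ y) (s : I) : affineParam x y s ∈ Icc x y :=
  segmentCurve_mem_Icc (Subtype.coe_le_coe.2 hxy) s

theorem exists_affineParam_eq {t : I} (ht : t ∈ Icc x y) : ∃ s, affineParam x y s = t := by
  have h := intermediate_value_univ 0 1 (continuous_affineParam x y)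
  rw [affineParam_zero, affineParam_one] at h
  exact h ht

theorem Shortcut.exists_reparam (hqp : ∀ t, |q t - p t| ≤ δ) (hp : Continuous p)
    (h : Shortcut δ q p x y) :
    ∃ φ : Reparam, ∀ s, |segmentCurve (q x) (q y) (φ.1 s) - p (affineParam x y s)| ≤ δ := by
  have hp' : Continuous (p ∘ affineParam x y) := hp.comp (continuous_affineParam x y)
  have h' : Shortcut δ (q ∘ affineParam x y) (p ∘ affineParam x y) 0 1 :=
    .comp (by rwa [affineParam_zero, affineParam_one]) (affineParam_monotone h.le) zero_le_one
  rcases h' with hup | hdown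
  · obtain ⟨φ, hφ⟩ := hup.exists_reparam (fun _ ↦ hqp _) hp'
    exact ⟨φ, by simpa only [Function.comp_apply, affineParam_zero, affineParam_one] using hφ⟩
  · obtain ⟨φ, hφ⟩ := hdown.exists_reparam (abs_neg_sub_neg_le fun _ ↦ hqp _) hp'.neg
    refine ⟨φ, fun s ↦ ?_⟩
    simpa only [Pi.neg_apply, Function.comp_apply, affineParam_zero, affineParam_one,
      segmentCurve_neg, neg_sub_neg, abs_sub_comm] using hφ s

theorem Shortcut.frechetDist_subcurve_le {F : C(I, ℝ)} (hδ : 0 ≤ δ)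
    (h : Shortcut δ F p x y) : frechetDist (segmentCurve (F x) (F y)) (subcurve F x y) ≤ δ := by
  obtain ⟨φ, hφ⟩ := h.self.exists_reparam (by simpa using hδ) F.continuous
  exact frechetDist_le φ Reparam.refl hφ

end Tracking

/-! ### Concatenation of shortcuts -/

section Concatenation

theorem exists_mem_Icc_castSucc_succ {τ : Type*} [LinearOrder τ] {l : ℕ} (hl : l ≠ 0)
    {T : Fin (l + 1) → τ} {t : τ} (h₀ : T 0 ≤ t) (h₁ : t ≤ T (Fin.last l)) :
    ∃ k : Fin l, t ∈ Icc (T k.castSucc) (T k.succ) := by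
  suffices ∀ j, 0 < j → t ≤ T j → ∃ k : Fin l, t ∈ Icc (T k.castSucc) (T k.succ) from
    this (Fin.last l) (Fin.pos_of_ne_zero (mt Fin.val_eq_of_eq hl)) h₁
  intro j
  induction j using Fin.induction with
  | zero => exact fun h ↦ absurd h (lt_irrefl 0)
  | succ j ih =>
    intro _ htj
    rcases le_or_gt (T j.castSucc) t with hjt | hjt
    · exact ⟨j, hjt, htj⟩
    · exact ih (Fin.pos_of_ne_zero fun hj ↦ (hj ▸ hjt).not_ge h₀) hjt.le

theorem sum_sub_mul_eq_of_step {l : ℕ} (v : Fin (l + 1) → ℝ) {a : Fin l → ℝ} (k : Fin l)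
    (h₁ : ∀ i < k, a i = 1) (h₀ : ∀ i, k < i → a i = 0) :
    ∑ i, (v i.succ - v i.castSucc) * a i =
      v k.castSucc - v 0 + (v k.succ - v k.castSucc) * a k := by
  have hbelow (i : Fin l) (hi : i ∈ Finset.Iio k) :
      (v i.succ - v i.castSucc) * a i = v i.succ - v i.castSucc := by
    rw [h₁ i (Finset.mem_Iio.1 hi), mul_one]
  have htel := Fin.sum_Iic_sub k v
  rw [← Finset.sum_subset (Finset.subset_univ (Finset.Iic k)) fun i _ hi ↦ by
    rw [h₀ i (not_le.1 (mt Finset.mem_Iic.2 hi)), mul_zero]]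
  rw [← Finset.Iio_insert, Finset.sum_insert (by simp)] at htel ⊢
  rw [Finset.sum_congr rfl hbelow]
  linarith

variable {x y : I}

theorem Reparam.exists_extension (φ : Reparam) (hxy : x < y) :
    ∃ Φ : I → I, Continuous Φ ∧ Monotone Φ ∧ (∀ t ≤ x, Φ t = 0) ∧ (∀ t, y ≤ t → Φ t = 1) ∧
      ∀ s, Φ (affineParam x y s) = φ.1 s := by
  have hxy' : (0 : ℝ) < y - x := sub_pos.2 hxy
  refine ⟨fun t ↦ φ.1 (projIcc 0 1 zero_le_one ((t - x) / (y - x))),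
    φ.continuous.comp (continuous_projIcc.comp (by fun_prop)), fun s t hst ↦ φ.2.1 ?_,
    fun t ht ↦ ?_, fun t ht ↦ ?_, fun s ↦ congrArg φ.1 ?_⟩
  · exact monotone_projIcc zero_le_one
      (div_le_div_of_nonneg_right (sub_le_sub_right (Subtype.coe_le_coe.2 hst) _) hxy'.le)
  · exact (congrArg φ.1 (projIcc_of_le_left zero_le_one
      (div_nonpos_of_nonpos_of_nonneg (sub_nonpos.2 ht) hxy'.le))).trans φ.map_zero
  · exact (congrArg φ.1 (projIcc_of_right_le zero_le_one
      ((one_le_div hxy').2 (sub_le_sub_right (Subtype.coe_le_coe.2 ht) _)))).trans φ.map_one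
  · rw [show ((affineParam x y s : ℝ) - x) / (y - x) = s by
      rw [coe_affineParam]; field_simp; ring, projIcc_val]

theorem Reparam.exists_concat {l : ℕ} {T : Fin (l + 1) → I} (hT : StrictMono T) (hT₀ : T 0 = 0)
    (hT₁ : T (Fin.last l) = 1) (φ : Fin l → Reparam) :
    ∃ ψ : Reparam, ∀ (k : Fin l) (s : I),
      (l : ℝ) * ψ.1 (affineParam (T k.castSucc) (T k.succ) s) = (k : ℕ) + (φ k).1 s := by
  have hl : (l : ℝ) ≠ 0 := by
    rintro hl
    obtain rfl : l = 0 := by exact_mod_cast hl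
    exact zero_ne_one (hT₀.symm.trans hT₁)
  choose Φ hΦ hΦ_mono hΦ₀ hΦ₁ hΦφ using fun i ↦
    (φ i).exists_extension (hT (Fin.castSucc_lt_succ (i := i)))
  obtain ⟨ψ, hψ⟩ := Reparam.exists_coe_eq (Φ := fun t ↦ (∑ i, (Φ i t : ℝ)) / l) (by fun_prop)
    (fun s t hst ↦ div_le_div_of_nonneg_right (Finset.sum_le_sum fun i _ ↦ hΦ_mono i hst)
      l.cast_nonneg)
    (by simp [hΦ₀ _ 0 unitInterval.nonneg'])
    (by simp [hΦ₁ _ 1 unitInterval.le_one', hl])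
  refine ⟨ψ, fun k s ↦ ?_⟩
  have hmem := affineParam_mem_Icc (hT.monotone (Fin.castSucc_lt_succ (i := k)).le) s
  have hstep := sum_sub_mul_eq_of_step (fun i ↦ ((i : ℕ) : ℝ)) k
    (a := fun i ↦ (Φ i (affineParam (T k.castSucc) (T k.succ) s) : ℝ))
    (fun i hi ↦ by simp [hΦ₁ i _ ((hT.monotone (Fin.succ_le_castSucc_iff.2 hi)).trans hmem.1)])
    (fun i hi ↦ by simp [hΦ₀ i _ (hmem.2.trans (hT.monotone (Fin.succ_le_castSucc_iff.2 hi)))])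
  rw [hψ, mul_div_cancel₀ _ hl]
  simpa [hΦφ] using hstep

end Concatenation

namespace PolygonalCurve

variable (P : PolygonalCurve)

theorem curve_eq_segmentCurve {k : Fin P.numEdges} {t s : I}
    (h : (P.numEdges : ℝ) * t = (k : ℕ) + s) :
    P.curve t = segmentCurve (P.vertex k.castSucc) (P.vertex k.succ) s := by
  have hbelow (i : Fin P.numEdges) (hi : i < k) :
      max 0 (min 1 ((P.numEdges : ℝ) * t - (i : ℕ))) = 1 := by
    have : ((i : ℕ) : ℝ) + 1 ≤ (k : ℕ) := by exact_mod_cast hi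
    rw [min_eq_left (by linarith [s.2.1]), max_eq_right zero_le_one]
  have habove (i : Fin P.numEdges) (hi : k < i) :
      max 0 (min 1 ((P.numEdges : ℝ) * t - (i : ℕ))) = 0 := by
    have : ((k : ℕ) : ℝ) + 1 ≤ (i : ℕ) := by exact_mod_cast hi
    exact max_eq_left ((min_le_right _ _).trans (by linarith [s.2.2]))
  have hat : max 0 (min 1 ((P.numEdges : ℝ) * t - (k : ℕ))) = s := by
    rw [h, add_sub_cancel_left, min_eq_right s.2.2, max_eq_right s.2.1]
  calc P.curve t = P.vertex 0 + ∑ i : Fin P.numEdges, (P.vertex i.succ - P.vertex i.castSucc) *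
        max 0 (min 1 ((P.numEdges : ℝ) * t - (i : ℕ))) := rfl
    _ = segmentCurve (P.vertex k.castSucc) (P.vertex k.succ) s := by
      rw [sum_sub_mul_eq_of_step P.vertex k hbelow habove, hat, segmentCurve_apply]
      ring

theorem curve_eq_vertex {t : I} {k : Fin (P.numEdges + 1)}
    (h : (P.numEdges : ℝ) * t = (k : ℕ)) : P.curve t = P.vertex k := by
  rcases P with ⟨_ | n, v⟩
  · simp [curve, show k = 0 from Subsingleton.elim (α := Fin 1) k 0]
  · rcases Fin.eq_castSucc_or_eq_last k with ⟨j, rfl⟩ | rfl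
    · rw [curve_eq_segmentCurve (k := j) (s := 0) _ (by simpa using h)]
      simp [segmentCurve_apply]
    · rw [curve_eq_segmentCurve (k := Fin.last n) (s := 1) _ (by simpa using h)]
      simp [segmentCurve_apply]

theorem numEdges_mul_param (k : Fin (P.numEdges + 1)) :
    (P.numEdges : ℝ) * P.param k = (k : ℕ) := by
  rcases Nat.eq_zero_or_pos P.numEdges with h | h
  · have := k.2
    simp [h, show (k : ℕ) = 0 by lia]
  · exact mul_div_cancel₀ _ (by positivity)

theorem curve_param (k : Fin (P.numEdges + 1)) : P.curve (P.param k) = P.vertex k :=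
  P.curve_eq_vertex (P.numEdges_mul_param k)

theorem param_strictMono : StrictMono P.param := fun i j hij ↦ by
  have hij' : ((i : ℕ) : ℝ) < (j : ℕ) := by exact_mod_cast hij
  rw [← P.numEdges_mul_param, ← P.numEdges_mul_param] at hij'
  exact Subtype.coe_lt_coe.1 (lt_of_mul_lt_mul_left hij' (Nat.cast_nonneg _))

theorem param_zero : P.param 0 = 0 :=
  Subtype.ext (by simp [param])

theorem param_last (h : P.numEdges ≠ 0) : P.param (Fin.last _) = 1 :=
  Subtype.ext (by simp [param, h])

variable {P}

theorem exists_mem_Icc_param (h : P.numEdges ≠ 0) (t : I) :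
    ∃ k : Fin P.numEdges, t ∈ Icc (P.param k.castSucc) (P.param k.succ) :=
  exists_mem_Icc_castSucc_succ h (P.param_zero.trans_le unitInterval.nonneg')
    (unitInterval.le_one'.trans_eq (P.param_last h).symm)

theorem exists_numEdges_mul_eq {k : Fin P.numEdges} {t : I}
    (ht : t ∈ Icc (P.param k.castSucc) (P.param k.succ)) :
    ∃ s : I, (P.numEdges : ℝ) * t = (k : ℕ) + s := by
  have hleft := mul_le_mul_of_nonneg_left (Subtype.coe_le_coe.2 ht.1) P.numEdges.cast_nonneg
  have hright := mul_le_mul_of_nonneg_left (Subtype.coe_le_coe.2 ht.2) P.numEdges.cast_nonneg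
  rw [numEdges_mul_param] at hleft hright
  push_cast [Fin.val_succ, Fin.val_castSucc] at hleft hright
  exact ⟨⟨P.numEdges * t - (k : ℕ), by linarith, by linarith⟩, by simp⟩

theorem curve_monotoneOn_or_antitoneOn (k : Fin P.numEdges) :
    MonotoneOn P.curve (Icc (P.param k.castSucc) (P.param k.succ)) ∨
      AntitoneOn P.curve (Icc (P.param k.castSucc) (P.param k.succ)) := by
  refine (le_total (P.vertex k.castSucc) (P.vertex k.succ)).imp ?_ ?_ <;>
  · intro hv t ht t' ht' htt'
    obtain ⟨s, hs⟩ := exists_numEdges_mul_eq ht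
    obtain ⟨s', hs'⟩ := exists_numEdges_mul_eq ht'
    have hss' : (s : ℝ) ≤ s' := by
      linarith [mul_le_mul_of_nonneg_left (Subtype.coe_le_coe.2 htt') P.numEdges.cast_nonneg]
    rw [P.curve_eq_segmentCurve hs, P.curve_eq_segmentCurve hs', segmentCurve_apply,
      segmentCurve_apply]
    nlinarith

theorem frechetDist_curve_le_of_shortcuts {F : C(I, ℝ)} {g : Reparam} {q : I → ℝ} {δ : ℝ}
    (hqF : ∀ t, |q t - F (g.1 t)| ≤ δ) {T : Fin (P.numEdges + 1) → I} (hT : StrictMono T)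
    (hT₀ : T 0 = 0) (hT₁ : T (Fin.last _) = 1) (hv : ∀ i, P.vertex i = q (T i))
    (hS : ∀ k : Fin P.numEdges, Shortcut δ q (F ∘ g.1) (T k.castSucc) (T k.succ)) :
    frechetDist P.curve F ≤ δ := by
  choose φ hφ using fun k ↦ (hS k).exists_reparam hqF (F.continuous.comp g.continuous)
  obtain ⟨ψ, hψ⟩ := Reparam.exists_concat hT hT₀ hT₁ φ
  refine frechetDist_le ψ g fun t ↦ ?_
  have hn : P.numEdges ≠ 0 := fun h ↦ by
    rw [show Fin.last P.numEdges = 0 from Fin.ext h, hT₀] at hT₁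
    exact zero_ne_one hT₁
  obtain ⟨k, hk⟩ := exists_mem_Icc_castSucc_succ hn (t := t)
    (hT₀.trans_le unitInterval.nonneg') (unitInterval.le_one'.trans_eq hT₁.symm)
  obtain ⟨s, rfl⟩ := exists_affineParam_eq hk
  rw [P.curve_eq_segmentCurve (hψ k s), hv, hv]
  exact hφ k s

end PolygonalCurve

/-! ### Peaks and visits -/

section Oscillation

variable {α : Type*} {q : α → ℝ} {c : ℝ} {A B : Set α} {x y : α}

/-- On the set `A`, the values of `q` stay within an interval of length `c`. -/
def OscLE (q : α → ℝ) (c : ℝ) (A : Set α) : Prop :=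
  ∃ b, MapsTo q A (Icc b (b + c))

namespace OscLE

theorem abs_sub_le (h : OscLE q c A) (hx : x ∈ A) (hy : y ∈ A) : |q x - q y| ≤ c := by
  obtain ⟨b, hb⟩ := h
  rw [abs_le]
  constructor <;> linarith [(hb hx).1, (hb hx).2, (hb hy).1, (hb hy).2]

theorem mono {d : ℝ} (h : OscLE q c A) (hcd : c ≤ d) (hBA : B ⊆ A) : OscLE q d B := by
  obtain ⟨b, hb⟩ := h
  exact ⟨b, fun s hs ↦ Icc_subset_Icc_right (by linarith) (hb (hBA hs))⟩

theorem singleton (hc : 0 ≤ c) (x : α) : OscLE q c {x} :=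
  ⟨q x, by rintro s rfl; exact ⟨le_rfl, by linarith⟩⟩

theorem neg (h : OscLE q c A) : OscLE (-q) c A := by
  obtain ⟨b, hb⟩ := h
  exact ⟨-(b + c), fun s hs ↦ ⟨neg_le_neg (hb hs).2, (neg_le_neg (hb hs).1).trans_eq (by ring)⟩⟩

theorem of_mem_uIcc (hxy : |q y - q x| ≤ c) (h : ∀ s ∈ A, q s ∈ uIcc (q x) (q y)) :
    OscLE q c A :=
  ⟨min (q x) (q y), fun s hs ↦ Icc_subset_Icc_right
    (by linarith [max_sub_min_eq_abs (q x) (q y)]) (h s hs)⟩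

theorem union_of_mem_uIcc (h : OscLE q c A) (hx : x ∈ A) (hy : y ∈ A)
    (hB : ∀ s ∈ B, q s ∈ uIcc (q x) (q y)) : OscLE q c (A ∪ B) := by
  obtain ⟨b, hb⟩ := h
  exact ⟨b, mapsTo_union.2 ⟨hb, fun s hs ↦ ordConnected_Icc.uIcc_subset (hb hx) (hb hy) (hB s hs)⟩⟩

end OscLE

end Oscillation

section Peaks

variable {τ ρ : Type*} [LinearOrder τ] [LinearOrder ρ] {δ c : ℝ} {q p : τ → ℝ} {V : Set τ}
  {x y z w : τ}

/-- Whenever `p` has an interior peak between `x` and `z`, its maximum there is attained in `V`.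
For a polygonal curve `p`, this holds with `V` its set of vertices. -/
def HasPeaksIn (p : τ → ℝ) (V : Set τ) : Prop :=
  ∀ x y z, x ≤ y → y ≤ z → p x < p y → p z < p y → ∃ θ ∈ V, θ ∈ Icc x z ∧ IsMaxOn p (Icc x z) θ

theorem HasPeaksIn.of_piecewise_monotone [TopologicalSpace τ] [CompactIccSpace τ]
    (hp : Continuous p) (hV : ∀ t, ∃ a ∈ V, ∃ b ∈ V, t ∈ Icc a b ∧
      (MonotoneOn p (Icc a b) ∨ AntitoneOn p (Icc a b))) : HasPeaksIn p V := by
  intro x y z hxy hyz hpx hpz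
  obtain ⟨s, hs, hmax⟩ :=
    (isCompact_Icc (a := x) (b := z)).exists_isMaxOn ⟨y, hxy, hyz⟩ hp.continuousOn
  have hys : p y ≤ p s := hmax ⟨hxy, hyz⟩
  obtain ⟨a, ha, b, hb, hsab, hmono | hanti⟩ := hV s
  · have hbz : b ≤ z := le_of_not_gt fun hzb ↦
      (hmono hsab ⟨hsab.1.trans hs.2, hzb.le⟩ hs.2).not_gt (hpz.trans_le hys)
    exact ⟨b, hb, ⟨hs.1.trans hsab.2, hbz⟩, fun t ht ↦
      (hmax ht).trans (hmono hsab ⟨hsab.1.trans hsab.2, le_rfl⟩ hsab.2)⟩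
  · have hxa : x ≤ a := le_of_not_gt fun hax ↦
      (hanti ⟨hax.le, hs.1.trans hsab.2⟩ hsab hs.1).not_gt (hpx.trans_le hys)
    exact ⟨a, ha, ⟨hxa, hsab.1.trans hs.2⟩, fun t ht ↦
      (hmax ht).trans (hanti ⟨le_rfl, hsab.1.trans hsab.2⟩ hsab hsab.1)⟩

theorem HasPeaksIn.comp (h : HasPeaksIn p V) {g : ρ → τ} (hg : Monotone g)
    (hg' : Function.Surjective g) : HasPeaksIn (p ∘ g) (g ⁻¹' V) := by
  intro x y z hxy hyz hpx hpz
  obtain ⟨θ, hθV, hθ, hmax⟩ := h _ _ _ (hg hxy) (hg hyz) hpx hpz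
  obtain ⟨t, rfl⟩ := hg' θ
  have hclamp : g (max x (min z t)) = g t := by
    rw [hg.map_max, hg.map_min, min_eq_right hθ.2, max_eq_right hθ.1]
  refine ⟨max x (min z t), by rwa [mem_preimage, hclamp],
    ⟨le_max_left _ _, max_le (hxy.trans hyz) (min_le_left _ _)⟩, fun s hs ↦ ?_⟩
  rw [mem_ofPred_eq, Function.comp_apply, Function.comp_apply, hclamp]
  exact hmax ⟨hg hs.1, hg hs.2⟩

/-- `q` ascends from `x` to `y` and descends from `y` to `z`, with its apex at `y`. -/
structure IsPeak (δ : ℝ) (q p : τ → ℝ) (x y z : τ) : Prop where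
  ascends : Ascends δ q p x y
  descends : Ascends δ (-q) (-p) y z
  left_lt : q x < q y
  right_lt : q z < q y

namespace IsPeak

theorem of_ascends (hδ : 0 ≤ δ) (hqp : ∀ t, |q t - p t| ≤ δ) (h : Ascends δ q p x y)
    (h' : Shortcut δ q p y z) (hxz : ¬Shortcut δ q p x z) : IsPeak δ q p x y z := by
  have hup : ¬Ascends δ q p y z := fun h' ↦ hxz (.inl (h.trans hδ hqp h'))
  have hdown : Ascends δ (-q) (-p) y z := h'.resolve_left hup
  refine ⟨h, hdown, (h.mapsTo ⟨h.le, le_rfl⟩).1.lt_of_ne fun heq ↦ hxz (.inr ?_),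
    (neg_le_neg_iff.1 (hdown.mapsTo ⟨hdown.le, le_rfl⟩).1).lt_of_ne fun heq ↦ hup ?_⟩
  · have hflat : Ascends δ (-q) (-p) x y :=
      .of_neg_of_eq hδ (abs_neg_sub_neg_le hqp) (by simpa using h) (congrArg Neg.neg heq)
    exact hflat.trans hδ (abs_neg_sub_neg_le hqp) hdown
  · exact .of_neg_of_eq hδ hqp hdown heq.symm

theorem or_neg_of_not_shortcut (hδ : 0 ≤ δ) (hqp : ∀ t, |q t - p t| ≤ δ)
    (h : Shortcut δ q p x y) (h' : Shortcut δ q p y z)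
    (hxz : ¬Shortcut δ q p x z) : IsPeak δ q p x y z ∨ IsPeak δ (-q) (-p) x y z :=
  h.imp (fun h ↦ of_ascends hδ hqp h h' hxz) fun h ↦
    of_ascends hδ (abs_neg_sub_neg_le hqp) h h'.neg fun hxz' ↦
      hxz (by simpa only [neg_neg] using hxz'.neg)

theorem apex_mem (h : IsPeak δ q p x y z) : y ∈ Icc x z :=
  ⟨h.ascends.le, h.descends.le⟩

theorem le_apex (h : IsPeak δ q p x y z) {s : τ} (hs : s ∈ Icc x z) : q s ≤ q y := by
  rcases le_total s y with hsy | hys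
  · exact (h.ascends.mapsTo ⟨hs.1, hsy⟩).2
  · exact neg_le_neg_iff.1 (h.descends.mapsTo ⟨hys, hs.2⟩).1

theorem oscLE_uIcc (h : IsPeak δ q p x y z) {θ : τ} (hθ : θ ∈ Icc x z)
    (hqθ : q y - 2 * δ ≤ q θ) : OscLE q (4 * δ) (uIcc θ y) := by
  refine ⟨q y - 4 * δ, fun s hs ↦ ⟨?_, ?_⟩⟩
  · suffices q θ - q s ≤ 2 * δ by linarith
    rcases mem_uIcc.1 hs with hs | hs
    · exact h.ascends.dropLE_left θ ⟨hθ.1, hs.1.trans hs.2⟩ s ⟨hθ.1.trans hs.1, hs.2⟩ hs.1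
    · have := h.descends.dropLE_left s ⟨hs.1, hs.2.trans hθ.2⟩ θ ⟨hs.1.trans hs.2, hθ.2⟩ hs.2
      simpa only [Pi.neg_apply, neg_sub_neg] using this
  · rw [sub_add_cancel]
    exact h.le_apex (ordConnected_Icc.uIcc_subset hθ h.apex_mem hs)

theorem exists_visit (h : IsPeak δ q p x y z) (hqp : ∀ t, |q t - p t| ≤ δ) (hp : HasPeaksIn p V)
    {u : τ} (hu : u ∈ Icc x z) (hxu : q x + δ < p u)
    (hzu : q z + δ < p u) (hyu : q y - δ ≤ p u) :
    ∃ θ ∈ V, θ ∈ Icc x z ∧ OscLE q (4 * δ) (uIcc θ y) := by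
  obtain ⟨θ, hθV, hθ, hmax⟩ := hp x u z hu.1 hu.2 (by linarith [(abs_le.1 (hqp x)).1])
    (by linarith [(abs_le.1 (hqp z)).1])
  have hle : p u ≤ p θ := hmax hu
  exact ⟨θ, hθV, hθ, h.oscLE_uIcc hθ (by linarith [(abs_le.1 (hqp θ)).1])⟩

theorem exists_visit_of_long (h : IsPeak δ q p x y z) (hqp : ∀ t, |q t - p t| ≤ δ)
    (hp : HasPeaksIn p V) (hx : q x + 2 * δ < q y)
    (hz : q z + 2 * δ < q y) : ∃ θ ∈ V, θ ∈ Icc x z ∧ OscLE q (4 * δ) (uIcc θ y) := by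
  have hpy := (abs_le.1 (hqp y)).2
  exact h.exists_visit hqp hp h.apex_mem (by linarith) (by linarith) (by linarith)

theorem exists_drop_of_not_shortcut (hy : IsPeak δ q p x y z) (hz : IsPeak δ (-q) (-p) y z w)
    (hqxz : q x ≤ q z) (hqyw : q y ≤ q w) (hqyz : q y - q z ≤ 2 * δ)
    (hxw : ¬Shortcut δ q p x w) :
    ∃ s ∈ Icc x z, ∃ t ∈ Icc y w, 2 * δ < p s - p t := by
  by_contra! hdrop
  have hzw' : Ascends δ q p z w := by simpa only [neg_neg] using hz.descends
  have hz_le {t : τ} (ht : t ∈ Icc y w) : q z ≤ q t := neg_le_neg_iff.1 (hz.le_apex ht)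
  refine hxw (.inl ⟨hy.ascends.le.trans (hz.ascends.le.trans hz.descends.le), fun s hs ↦ ?_,
    hy.ascends.dropLE_left.union_of_cross hzw'.dropLE_left
      fun s hs t ht _ ↦ by linarith [hy.le_apex hs, hz_le ht],
    hy.ascends.dropLE_right.union_of_cross hzw'.dropLE_right fun s hs t ht _ ↦ hdrop s hs t ht⟩)
  constructor
  · rcases le_total s y with hsy | hys
    · exact (hy.ascends.mapsTo ⟨hs.1, hsy⟩).1
    · exact hqxz.trans (hz_le ⟨hys, hs.2⟩)
  · rcases le_total s z with hsz | hzs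
    · exact (hy.le_apex ⟨hs.1, hsz⟩).trans hqyw
    · exact (hzw'.mapsTo ⟨hzs, hs.2⟩).2

theorem exists_visits_of_not_shortcut (hy : IsPeak δ q p x y z) (hz : IsPeak δ (-q) (-p) y z w)
    (hqp : ∀ t, |q t - p t| ≤ δ) (hp : HasPeaksIn p V) (hp' : HasPeaksIn (-p) V)
    (hqxz : q x ≤ q z) (hqyw : q y ≤ q w)
    (hqyz : q y - q z ≤ 2 * δ) (hxw : ¬Shortcut δ q p x w) :
    (∃ θ ∈ V, θ ∈ Icc x z ∧ OscLE q (4 * δ) (uIcc θ y)) ∧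
      ∃ θ ∈ V, θ ∈ Icc y w ∧ OscLE q (4 * δ) (uIcc θ z) := by
  obtain ⟨s, hs, t, ht, hst⟩ := hy.exists_drop_of_not_shortcut hz hqxz hqyw hqyz hxw
  have hps : p s ≤ q y + δ := by linarith [(abs_le.1 (hqp s)).1, hy.le_apex hs]
  have hpt : q z - δ ≤ p t := by
    linarith [(abs_le.1 (hqp t)).2, neg_le_neg_iff.1 (hz.le_apex ht)]
  refine ⟨hy.exists_visit hqp hp hs (by linarith) (by linarith) (by linarith), ?_⟩
  obtain ⟨θ, hθV, hθ, hosc⟩ := hz.exists_visit (abs_neg_sub_neg_le hqp) hp' ht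
    (by simp only [Pi.neg_apply]; linarith) (by simp only [Pi.neg_apply]; linarith)
    (by simp only [Pi.neg_apply]; linarith)
  exact ⟨θ, hθV, hθ, by simpa only [neg_neg] using hosc.neg⟩

end IsPeak

end Peaks

/-! ### Taut chains -/

theorem exists_relSeries_forall_notMem {α : Type*} {r : SetRel α α} (s : RelSeries r) :
    ∃ s' : RelSeries r, s'.head = s.head ∧ s'.last = s.last ∧
      ∀ i j : Fin (s'.length + 1), (i : ℕ) + 1 < j → (s' i, s' j) ∉ r := by
  obtain ⟨s', ⟨hhead, hlast⟩, hmin⟩ := exists_minimalFor_of_wellFoundedLT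
    (fun s' : RelSeries r ↦ s'.head = s.head ∧ s'.last = s.last) RelSeries.length ⟨s, rfl, rfl⟩
  refine ⟨s', hhead, hlast, fun i j hij hr ↦ ?_⟩
  let bypass := (s'.take i).append (s'.drop j) (by simpa using hr)
  have hlength : bypass.length = i + (s'.length - j) + 1 := by
    simp [bypass, RelSeries.append_length]
  have := hmin (j := bypass) ⟨by simp [bypass, hhead], by simp [bypass, hlast]⟩ (by lia)
  lia

section TautChains

variable {τ : Type*} [LinearOrder τ] {δ c : ℝ} {q p : τ → ℝ} {V : Set τ} {x y z t θ : τ}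

theorem uIcc_subset_uIcc_of_notMem {a b d : ℝ} (hb : b ∉ uIcc a d) (h : |b - a| ≤ |d - b|) :
    uIcc a b ⊆ uIcc b d := by
  refine uIcc_subset_uIcc (mem_uIcc.2 ?_) left_mem_uIcc
  by_contra! hda
  refine hb (mem_uIcc.2 ?_)
  rcases abs_cases (b - a) with ⟨_, _⟩ | ⟨_, _⟩ <;>
  rcases abs_cases (d - b) with ⟨_, _⟩ | ⟨_, _⟩ <;> grind

theorem IsPeak.notMem_uIcc (h : IsPeak δ q p x y z) : q y ∉ uIcc (q x) (q z) :=
  notMem_uIcc_of_gt h.left_lt h.right_lt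

namespace OscLE

theorem uIcc_left (hθ : OscLE q c (uIcc θ y)) (hA : OscLE q c (uIcc x z)) (hxy : x ≤ y)
    (hθz : θ ≤ z) : OscLE q c (uIcc θ x) := by
  rcases le_total θ x with h | h
  · refine hθ.mono le_rfl ?_
    rw [uIcc_of_le h, uIcc_of_le (h.trans hxy)]
    exact Icc_subset_Icc_right hxy
  · refine hA.mono le_rfl ?_
    rw [uIcc_of_ge h, uIcc_of_le (h.trans hθz)]
    exact Icc_subset_Icc_right hθz

theorem uIcc_right (hθ : OscLE q c (uIcc θ y)) (hA : OscLE q c (uIcc x z)) (hyx : y ≤ x)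
    (hzθ : z ≤ θ) : OscLE q c (uIcc θ x) := by
  rcases le_total x θ with h | h
  · refine hθ.mono le_rfl ?_
    rw [uIcc_of_ge h, uIcc_of_ge (hyx.trans h)]
    exact Icc_subset_Icc_left hyx
  · refine hA.mono le_rfl ?_
    rw [uIcc_of_le h, uIcc_of_ge (hzθ.trans h)]
    exact Icc_subset_Icc_left hzθ

theorem union_uIcc_of_mem (h : OscLE q c (uIcc t y ∪ uIcc t z))
    (hxy : ∀ s ∈ uIcc x y, q s ∈ uIcc (q y) (q z)) : OscLE q c (uIcc t x ∪ uIcc t y) := by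
  refine (h.union_of_mem_uIcc (.inl right_mem_uIcc) (.inr right_mem_uIcc) hxy).mono le_rfl
    (union_subset ?_ (subset_union_left.trans subset_union_left))
  rw [uIcc_comm x y]
  exact uIcc_subset_uIcc_union_uIcc.trans (union_subset_union_left _ subset_union_left)

end OscLE

variable {l : ℕ} {T : Fin (l + 1) → τ}

/-- The length of the `j`-th edge of the polygonal curve with vertices `q (T 0), q (T 1), …`. -/
def edgeLength (q : τ → ℝ) (T : Fin (l + 1) → τ) (j : Fin l) : ℝ :=
  |q (T j.succ) - q (T j.castSucc)|

omit [LinearOrder τ] in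
theorem edgeLength_neg (q : τ → ℝ) (T : Fin (l + 1) → τ) :
    edgeLength (-q) T = edgeLength q T := by
  ext j
  simp only [edgeLength, Pi.neg_apply, neg_sub_neg, abs_sub_comm]

/-- The parameters `T` cut `q` into shortcuts, and no shortcut bypasses any of them. -/
structure IsTautChain (δ : ℝ) (q p : τ → ℝ) (T : Fin (l + 1) → τ) : Prop where
  strictMono : StrictMono T
  shortcut : ∀ k : Fin l, Shortcut δ q p (T k.castSucc) (T k.succ)
  not_shortcut : ∀ i j : Fin (l + 1), (i : ℕ) + 1 < j → ¬Shortcut δ q p (T i) (T j)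

namespace IsTautChain

variable {i : Fin (l + 1)} {h j k : Fin l}

theorem neg (hT : IsTautChain δ q p T) : IsTautChain δ (-q) (-p) T where
  strictMono := hT.strictMono
  shortcut k := (hT.shortcut k).neg
  not_shortcut i j hij h := hT.not_shortcut i j hij (by simpa only [neg_neg] using h.neg)

theorem mem_uIcc (hT : IsTautChain δ q p T) {s : τ} (hs : s ∈ uIcc (T j.castSucc) (T j.succ)) :
    q s ∈ uIcc (q (T j.castSucc)) (q (T j.succ)) :=
  (hT.shortcut j).mem_uIcc (by rwa [uIcc_of_le (hT.shortcut j).le] at hs)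

theorem isPeak_or_neg (hT : IsTautChain δ q p T) (hδ : 0 ≤ δ) (hqp : ∀ t, |q t - p t| ≤ δ)
    (hhk : h.succ = k.castSucc) : IsPeak δ q p (T h.castSucc) (T h.succ) (T k.succ) ∨
      IsPeak δ (-q) (-p) (T h.castSucc) (T h.succ) (T k.succ) := by
  refine IsPeak.or_neg_of_not_shortcut hδ hqp (hT.shortcut h) (hhk ▸ hT.shortcut k)
    (hT.not_shortcut _ _ ?_)
  simp only [Fin.ext_iff, Fin.val_succ, Fin.val_castSucc] at hhk ⊢
  lia

theorem notMem_uIcc (hT : IsTautChain δ q p T) (hδ : 0 ≤ δ) (hqp : ∀ t, |q t - p t| ≤ δ)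
    (hhk : h.succ = k.castSucc) :
    q (T h.succ) ∉ uIcc (q (T h.castSucc)) (q (T k.succ)) := by
  rcases hT.isPeak_or_neg hδ hqp hhk with hpeak | hpeak
  · exact hpeak.notMem_uIcc
  · exact notMem_uIcc_of_lt (neg_lt_neg_iff.1 hpeak.left_lt) (neg_lt_neg_iff.1 hpeak.right_lt)

theorem exists_visits_of_short_edge (hT : IsTautChain δ q p T) (hδ : 0 ≤ δ)
    (hqp : ∀ t, |q t - p t| ≤ δ) (hp : HasPeaksIn p V) (hp' : HasPeaksIn (-p) V)
    (hhj : h.succ = j.castSucc) (hjk : j.succ = k.castSucc)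
    (hj : edgeLength q T j ≤ 2 * δ) (hjh : edgeLength q T j ≤ edgeLength q T h)
    (hjk' : edgeLength q T j ≤ edgeLength q T k) :
    (∃ θ ∈ V, θ ≤ T j.succ ∧ OscLE q (4 * δ) (uIcc θ (T j.castSucc))) ∧
      ∃ θ ∈ V, T j.castSucc ≤ θ ∧ OscLE q (4 * δ) (uIcc θ (T j.succ)) := by
  wlog hpeak : IsPeak δ q p (T h.castSucc) (T h.succ) (T j.succ) generalizing q p
  · have hvisits := this hT.neg (abs_neg_sub_neg_le hqp) hp' (by rwa [neg_neg])
      (by rwa [edgeLength_neg]) (by rwa [edgeLength_neg]) (by rwa [edgeLength_neg])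
      ((hT.isPeak_or_neg hδ hqp hhj).resolve_left hpeak)
    refine hvisits.imp ?_ ?_ <;>
    · rintro ⟨θ, hθ, hle, hosc⟩
      exact ⟨θ, hθ, hle, by simpa only [neg_neg] using hosc.neg⟩
  have hvalley : IsPeak δ (-q) (-p) (T j.castSucc) (T j.succ) (T k.succ) :=
    (hT.isPeak_or_neg hδ hqp hjk).resolve_left fun h' ↦
      h'.left_lt.not_gt (hhj ▸ hpeak.right_lt)
  have hhk : (h.castSucc : ℕ) + 1 < k.succ := by
    simp only [Fin.ext_iff, Fin.val_succ, Fin.val_castSucc] at hhj hjk ⊢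
    lia
  have hlt := hpeak.left_lt
  have hlt' : q (T j.succ) < q (T k.succ) := neg_lt_neg_iff.1 hvalley.right_lt
  rw [hhj] at hpeak hlt
  simp only [edgeLength, hhj, ← hjk, abs_of_neg (sub_neg.2 hpeak.right_lt),
    abs_of_pos (sub_pos.2 hlt), abs_of_pos (sub_pos.2 hlt')] at hj hjh hjk'
  obtain ⟨⟨θ, hθ, hle, hosc⟩, θ', hθ', hle', hosc'⟩ :=
    hpeak.exists_visits_of_not_shortcut hvalley hqp hp hp' (by linarith) (by linarith)
      (by linarith) (hT.not_shortcut _ _ hhk)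
  exact ⟨⟨θ, hθ, hle.2, hosc⟩, θ', hθ', hle'.1, hosc'⟩

theorem exists_visit_of_long_edges (hT : IsTautChain δ q p T) (hδ : 0 ≤ δ)
    (hqp : ∀ t, |q t - p t| ≤ δ) (hp : HasPeaksIn p V) (hp' : HasPeaksIn (-p) V)
    (hhk : h.succ = k.castSucc) (hh : 2 * δ < edgeLength q T h)
    (hk : 2 * δ < edgeLength q T k) :
    ∃ θ ∈ V, OscLE q (4 * δ) (uIcc θ (T h.succ)) := by
  wlog hpeak : IsPeak δ q p (T h.castSucc) (T h.succ) (T k.succ) generalizing q p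
  · obtain ⟨θ, hθ, hosc⟩ := this hT.neg (abs_neg_sub_neg_le hqp) hp' (by rwa [neg_neg])
      (by rwa [edgeLength_neg]) (by rwa [edgeLength_neg])
      ((hT.isPeak_or_neg hδ hqp hhk).resolve_left hpeak)
    exact ⟨θ, hθ, by simpa only [neg_neg] using hosc.neg⟩
  simp only [edgeLength, ← hhk, abs_of_pos (sub_pos.2 hpeak.left_lt),
    abs_of_neg (sub_neg.2 hpeak.right_lt)] at hh hk
  obtain ⟨θ, hθ, -, hosc⟩ := hpeak.exists_visit_of_long hqp hp (by linarith) (by linarith)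
  exact ⟨θ, hθ, hosc⟩

theorem exists_edge_le_neighbors (hT : IsTautChain δ q p T) (hδ : 0 ≤ δ)
    (hqp : ∀ t, |q t - p t| ≤ δ) (hi : i = j.castSucc ∨ i = j.succ)
    (hj : edgeLength q T j ≤ c) :
    ∃ j : Fin l, OscLE q c (uIcc (T i) (T j.castSucc) ∪ uIcc (T i) (T j.succ)) ∧
      ∀ k, k.succ = j.castSucc ∨ j.succ = k.castSucc →
        edgeLength q T j ≤ edgeLength q T k := by
  have hreach : OscLE q c (uIcc (T i) (T j.castSucc) ∪ uIcc (T i) (T j.succ)) :=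
    .of_mem_uIcc hj fun s hs ↦ hT.mem_uIcc <| by
      rcases hi with rfl | rfl
      · simpa using hs
      · simpa [uIcc_comm] using hs
  -- A shorter neighbour of an edge that `q` reaches from `T i` within oscillation `c` could be
  -- reached too.
  obtain ⟨m, hm, hmin⟩ := exists_min_image
    {j : Fin l | OscLE q c (uIcc (T i) (T j.castSucc) ∪ uIcc (T i) (T j.succ))}
    (edgeLength q T) (toFinite _) ⟨j, hreach⟩
  refine ⟨m, hm, fun k hk ↦ le_of_not_gt fun hlt ↦ hlt.not_ge (hmin k ?_)⟩
  rw [mem_ofPred_eq] at hm ⊢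
  rcases hk with hkm | hmk
  · have hsub := uIcc_subset_uIcc_of_notMem (hT.notMem_uIcc hδ hqp hkm)
      (by simpa only [edgeLength, hkm] using hlt.le)
    rw [← hkm] at hm
    exact hm.union_uIcc_of_mem fun s hs ↦ hsub (hT.mem_uIcc hs)
  · have hnotMem := hT.notMem_uIcc hδ hqp hmk
    rw [uIcc_comm] at hnotMem
    have hsub := uIcc_subset_uIcc_of_notMem hnotMem
      (by simpa only [edgeLength, ← hmk, abs_sub_comm] using hlt.le)
    rw [uIcc_comm (q _), hmk] at hsub
    rw [union_comm, hmk] at hm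
    rw [union_comm]
    refine hm.union_uIcc_of_mem fun s hs ↦ hsub (hT.mem_uIcc ?_)
    rwa [uIcc_comm]

theorem exists_visit_of_edge_le_neighbors (hT : IsTautChain δ q p T) (hδ : 0 ≤ δ)
    (hqp : ∀ t, |q t - p t| ≤ δ) (hp : HasPeaksIn p V) (hp' : HasPeaksIn (-p) V)
    (h₀ : T 0 ∈ V) (h₁ : T (Fin.last l) ∈ V)
    (hij : OscLE q (2 * δ) (uIcc (T i) (T j.castSucc) ∪ uIcc (T i) (T j.succ)))
    (hj : ∀ k, k.succ = j.castSucc ∨ j.succ = k.castSucc → edgeLength q T j ≤ edgeLength q T k) :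
    ∃ θ ∈ V, OscLE q (4 * δ) (uIcc θ (T i)) := by
  have hleft : OscLE q (4 * δ) (uIcc (T i) (T j.castSucc)) :=
    hij.mono (by linarith) subset_union_left
  have hright : OscLE q (4 * δ) (uIcc (T i) (T j.succ)) :=
    hij.mono (by linarith) subset_union_right
  rcases eq_or_ne j.castSucc 0 with hj₀ | hj₀
  · exact ⟨T 0, h₀, by rwa [uIcc_comm, ← hj₀]⟩
  rcases eq_or_ne j.succ (Fin.last l) with hj₁ | hj₁
  · exact ⟨T (Fin.last l), h₁, by rwa [uIcc_comm, ← hj₁]⟩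
  obtain ⟨h, hhj⟩ := Fin.exists_succ_eq.2 hj₀
  obtain ⟨k, hkj⟩ := Fin.exists_castSucc_eq.2 hj₁
  obtain ⟨⟨θ, hθ, hle, hosc⟩, θ', hθ', hle', hosc'⟩ :=
    hT.exists_visits_of_short_edge hδ hqp hp hp' hhj hkj.symm
      (hij.abs_sub_le (.inr right_mem_uIcc) (.inl right_mem_uIcc))
      (hj h (.inl hhj)) (hj k (.inr hkj.symm))
  rcases le_or_gt i j.castSucc with hi | hi
  · exact ⟨θ, hθ, hosc.uIcc_left hright (hT.strictMono.monotone hi) hle⟩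
  · exact ⟨θ', hθ', hosc'.uIcc_right hleft
      (hT.strictMono.monotone (Fin.castSucc_lt_iff_succ_le.1 hi)) hle'⟩

theorem exists_visit (hT : IsTautChain δ q p T) (hδ : 0 ≤ δ) (hqp : ∀ t, |q t - p t| ≤ δ)
    (hp : HasPeaksIn p V) (hp' : HasPeaksIn (-p) V) (h₀ : T 0 ∈ V) (h₁ : T (Fin.last l) ∈ V)
    (i : Fin (l + 1)) : ∃ θ ∈ V, OscLE q (4 * δ) (uIcc θ (T i)) := by
  by_cases hshort : ∃ j : Fin l, (i = j.castSucc ∨ i = j.succ) ∧ edgeLength q T j ≤ 2 * δ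
  · obtain ⟨j, hij, hj⟩ := hshort
    obtain ⟨m, hm, hmin⟩ := hT.exists_edge_le_neighbors hδ hqp hij hj
    exact hT.exists_visit_of_edge_le_neighbors hδ hqp hp hp' h₀ h₁ hm hmin
  · push Not at hshort
    have hself : OscLE q (4 * δ) (uIcc (T i) (T i)) := by
      rw [uIcc_self]
      exact .singleton (by linarith) _
    rcases eq_or_ne i 0 with rfl | hi₀
    · exact ⟨T 0, h₀, hself⟩
    rcases eq_or_ne i (Fin.last l) with rfl | hi₁
    · exact ⟨T (Fin.last l), h₁, hself⟩
    obtain ⟨h, rfl⟩ := Fin.exists_succ_eq.2 hi₀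
    obtain ⟨k, hk⟩ := Fin.exists_castSucc_eq.2 hi₁
    exact hT.exists_visit_of_long_edges hδ hqp hp hp' hk.symm (hshort h (.inr rfl))
      (hshort k (.inl hk.symm))

end IsTautChain

/-- Take the least label at each `i`: a visit for `T j` that comes before one for an earlier `T i`
serves for `T i`, too. -/
theorem exists_monotone_labels {ι κ : Type*} [Preorder ι] [LinearOrder κ] [WellFoundedLT κ]
    {T : ι → τ} (hT : Monotone T) {L : κ → τ → Prop}
    (hL : ∀ ⦃k k' θ θ'⦄, L k θ → L k' θ' → θ ≤ θ' → k ≤ k')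
    (hvisit : ∀ i, ∃ k θ, L k θ ∧ OscLE q c (uIcc θ (T i))) :
    ∃ f : ι → κ, Monotone f ∧ ∀ i, ∃ θ, L (f i) θ ∧ OscLE q c (uIcc θ (T i)) := by
  choose f hf hmin using fun i ↦ exists_minimal_of_wellFoundedLT _ (hvisit i)
  refine ⟨f, fun i j hij ↦ le_of_not_gt fun hlt ↦ hlt.not_ge (hmin i ?_ hlt.le), hf⟩
  obtain ⟨θ, hθ, hosc⟩ := hf i
  obtain ⟨θ', hθ', hosc'⟩ := hf j
  have hθθ' : θ' ≤ θ := le_of_not_ge fun h ↦ hlt.not_ge (hL hθ hθ' h)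
  refine ⟨θ', hθ', ?_⟩
  rcases le_total θ' (T i) with h | h
  · refine hosc'.mono le_rfl ?_
    rw [uIcc_of_le h, uIcc_of_le (h.trans (hT hij))]
    exact Icc_subset_Icc_right (hT hij)
  · refine hosc.mono le_rfl ?_
    rw [uIcc_of_ge h, uIcc_of_ge (h.trans hθθ')]
    exact Icc_subset_Icc_right hθθ'

end TautChains

/-! ### Straightenings -/

theorem exists_forall_gt_of_finite {X α : Type*} [Finite X] [LinearOrder α] [NoMaxOrder α]
    {p : X → α → Prop} {a : α} (hp : ∀ x, Monotone (p x)) (h : ∀ b, a < b → ∃ x, p x b) :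
    ∃ x, ∀ b, a < b → p x b := by
  by_contra! hcon
  choose e he hne using hcon
  have : Nonempty X := (exists_gt a).elim fun b hb ↦ (h b hb).nonempty
  obtain ⟨y, hy⟩ := Finite.exists_min e
  obtain ⟨x, hx⟩ := h (e y) (he y)
  exact hne x (hp x (hy x) hx)

namespace PolygonalCurve

/-- The parameters at which `P` passes through a vertex in its standard parametrization. If `P` has
no edges, these are all parameters. -/
def vertexParams (P : PolygonalCurve) : Set I :=
  {t | ∃ k : Fin (P.numEdges + 1), (P.numEdges : ℝ) * t = (k : ℕ)}

variable {P Q : PolygonalCurve}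

theorem param_mem_vertexParams (k : Fin (P.numEdges + 1)) : P.param k ∈ P.vertexParams :=
  ⟨k, P.numEdges_mul_param k⟩

theorem zero_mem_vertexParams : 0 ∈ P.vertexParams :=
  ⟨0, by simp⟩

theorem one_mem_vertexParams : 1 ∈ P.vertexParams :=
  ⟨Fin.last _, by simp⟩

theorem hasPeaksIn_vertexParams {r : I → ℝ} (hr : Continuous r)
    (hmono : ∀ k : Fin P.numEdges, MonotoneOn r (Icc (P.param k.castSucc) (P.param k.succ)) ∨
      AntitoneOn r (Icc (P.param k.castSucc) (P.param k.succ))) :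
    HasPeaksIn r P.vertexParams := by
  refine .of_piecewise_monotone hr fun t ↦ ?_
  rcases eq_or_ne P.numEdges 0 with h | h
  · have ht : t ∈ P.vertexParams := ⟨0, by simp [h]⟩
    exact ⟨t, ht, t, ht, ⟨le_rfl, le_rfl⟩, .inl (by simp)⟩
  · obtain ⟨k, hk⟩ := exists_mem_Icc_param h t
    exact ⟨_, param_mem_vertexParams _, _, param_mem_vertexParams _, hk, hmono k⟩

theorem hasPeaksIn_curve : HasPeaksIn P.curve P.vertexParams :=
  hasPeaksIn_vertexParams P.curve.continuous curve_monotoneOn_or_antitoneOn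

theorem hasPeaksIn_neg_curve : HasPeaksIn (-P.curve) P.vertexParams :=
  hasPeaksIn_vertexParams P.curve.continuous.neg fun k ↦
    (curve_monotoneOn_or_antitoneOn k).symm.imp AntitoneOn.neg MonotoneOn.neg

/-- The polygonal curve whose vertices are the vertices of `Q` with the indices `t 0, t 1, …`. -/
abbrev reindex (Q : PolygonalCurve) {l : ℕ} (t : Fin (l + 1) → Fin (Q.numEdges + 1)) :
    PolygonalCurve :=
  ⟨l, Q.vertex ∘ t⟩

/-- The vertices of `Q` with the indices `t` form a `δ`-straightening of `Q` that is close to `P`,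
with the visiting order `κ` on `P`. -/
structure IsVisitedStraightening (δ : ℝ) (P Q : PolygonalCurve) {l : ℕ}
    (t : Fin (l + 1) → Fin (Q.numEdges + 1)) (κ : Fin (l + 1) → Fin (P.numEdges + 1)) : Prop where
  isSimplification : IsSimplification δ Q (Q.reindex t) t
  isEdgeRangePreserving : IsEdgeRangePreserving Q (Q.reindex t) t
  isVisitingOrder : IsVisitingOrder (5 * δ) (Q.reindex t) P κ
  frechetDist_le : frechetDist (Q.reindex t).curve P.curve ≤ δ

variable {l : ℕ} {t : Fin (l + 1) → Fin (Q.numEdges + 1)} {κ : Fin (l + 1) → Fin (P.numEdges + 1)}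
  {δ ε : ℝ} {p : I → ℝ} {f g : Reparam}

theorem shortcut_lift_param (hδ : 0 ≤ δ) (hqp : ∀ s, |(Q.curve ∘ f.1) s - p s| ≤ δ)
    (k : Fin Q.numEdges) :
    Shortcut δ (Q.curve ∘ f.1) p (f.lift (Q.param k.castSucc)) (f.lift (Q.param k.succ)) := by
  have hle := f.lift_strictMono.monotone
    (Q.param_strictMono.monotone (Fin.castSucc_lt_succ (i := k)).le)
  have hmaps : MapsTo f.1 (Icc (f.lift (Q.param k.castSucc)) (f.lift (Q.param k.succ)))
      (Icc (Q.param k.castSucc) (Q.param k.succ)) := by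
    have := f.2.1.mapsTo_Icc (a := f.lift (Q.param k.castSucc)) (b := f.lift (Q.param k.succ))
    rwa [f.apply_lift, f.apply_lift] at this
  rcases Q.curve_monotoneOn_or_antitoneOn k with hmono | hanti
  · exact .inl (.of_monotoneOn hδ hqp (hmono.comp (f.2.1.monotoneOn _) hmaps) hle)
  · exact .inr (.of_monotoneOn hδ (abs_neg_sub_neg_le hqp)
      (hanti.comp_MonotoneOn (f.2.1.monotoneOn _) hmaps).neg hle)

theorem exists_isTautChain (hδ : 0 ≤ δ) (hqp : ∀ s, |(Q.curve ∘ f.1) s - p s| ≤ δ) :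
    ∃ (l : ℕ) (t : Fin (l + 1) → Fin (Q.numEdges + 1)), StrictMono t ∧ t 0 = 0 ∧
      t (Fin.last l) = Fin.last _ ∧
      IsTautChain δ (Q.curve ∘ f.1) p (f.lift ∘ Q.param ∘ t) := by
  let r : SetRel (Fin (Q.numEdges + 1)) (Fin (Q.numEdges + 1)) :=
    {ij | ij.1 < ij.2 ∧
      Shortcut δ (Q.curve ∘ f.1) p (f.lift (Q.param ij.1)) (f.lift (Q.param ij.2))}
  obtain ⟨s, hhead, hlast, hs⟩ := exists_relSeries_forall_notMem (r := r)
    ⟨Q.numEdges, id, fun k ↦ ⟨Fin.castSucc_lt_succ, shortcut_lift_param hδ hqp k⟩⟩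
  have hmono : StrictMono s := Fin.strictMono_iff_lt_succ.2 fun k ↦ (s.step k).1
  exact ⟨s.length, s, hmono, hhead, hlast,
    f.lift_strictMono.comp (Q.param_strictMono.comp hmono), fun k ↦ (s.step k).2,
    fun i j hij h ↦ hs i j hij ⟨hmono (Fin.lt_def.2 (by lia)), h⟩⟩

theorem vertex_reindex (f : Reparam) (i : Fin (l + 1)) :
    (Q.reindex t).vertex i = (Q.curve ∘ f.1) ((f.lift ∘ Q.param ∘ t) i) := by
  simp only [Function.comp_apply, f.apply_lift, Q.curve_param]

theorem nondegenerate_reindex (hT : IsTautChain δ (Q.curve ∘ f.1) p (f.lift ∘ Q.param ∘ t))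
    (hδ : 0 ≤ δ) (hqp : ∀ s, |(Q.curve ∘ f.1) s - p s| ≤ δ) : (Q.reindex t).Nondegenerate := by
  intro i j k hij hjk
  have hnotMem := hT.notMem_uIcc hδ hqp (h := ⟨i, by lia⟩) (k := ⟨j, by lia⟩) (Fin.ext hij)
  have hj : (⟨i, by lia⟩ : Fin l).succ = j := Fin.ext hij
  have hk : (⟨j, by lia⟩ : Fin l).succ = k := Fin.ext hjk
  rw [vertex_reindex f i, vertex_reindex f j, vertex_reindex f k, segment_eq_uIcc]
  rwa [hj, hk] at hnotMem

theorem shortcut_param (hT : IsTautChain δ (Q.curve ∘ f.1) p (f.lift ∘ Q.param ∘ t))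
    (k : Fin l) :
    Shortcut δ Q.curve (p ∘ f.lift) (Q.param (t k.castSucc)) (Q.param (t k.succ)) := by
  have hinv : (Q.curve ∘ f.1) ∘ f.lift = Q.curve := by
    ext s
    simp only [Function.comp_apply, f.apply_lift]
  have hle := f.lift_strictMono.le_iff_le.1 (hT.shortcut k).le
  exact hinv ▸ Shortcut.comp (f := f.lift) (a := Q.param (t k.castSucc))
    (b := Q.param (t k.succ)) (hT.shortcut k) f.lift_strictMono.monotone hle

theorem exists_isVisitingOrder_reindex
    (hT : IsTautChain δ (Q.curve ∘ f.1) (P.curve ∘ g.1) (f.lift ∘ Q.param ∘ t)) (hδ : 0 ≤ δ)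
    (hqp : ∀ s, |(Q.curve ∘ f.1) s - (P.curve ∘ g.1) s| ≤ δ)
    (h₀ : f.lift (Q.param (t 0)) = 0) (h₁ : f.lift (Q.param (t (Fin.last l))) = 1) :
    ∃ κ, IsVisitingOrder (5 * δ) (Q.reindex t) P κ := by
  have hvisit := hT.exists_visit hδ hqp (hasPeaksIn_curve.comp g.2.1 g.2.2)
    (hasPeaksIn_neg_curve.comp g.2.1 g.2.2)
    (by simp [h₀, g.map_zero, zero_mem_vertexParams])
    (by simp [h₁, g.map_one, one_mem_vertexParams])
  obtain ⟨κ, hκ_mono, hκ⟩ := exists_monotone_labels hT.strictMono.monotone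
    (L := fun (k : Fin (P.numEdges + 1)) θ ↦ (P.numEdges : ℝ) * g.1 θ = (k : ℕ))
    (fun k k' θ θ' hk hk' hθ ↦ by
      have := mul_le_mul_of_nonneg_left (Subtype.coe_le_coe.2 (g.2.1 hθ)) P.numEdges.cast_nonneg
      rw [hk, hk'] at this
      exact_mod_cast this)
    (fun i ↦ let ⟨θ, ⟨k, hk⟩, hosc⟩ := hvisit i; ⟨k, θ, hk, hosc⟩)
  refine ⟨κ, hκ_mono, fun i ↦ ?_⟩
  obtain ⟨θ, hθ, hosc⟩ := hκ i
  calc |(Q.reindex t).vertex i - P.vertex (κ i)|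
      = |(Q.curve ∘ f.1) ((f.lift ∘ Q.param ∘ t) i) - (P.curve ∘ g.1) θ| := by
        rw [vertex_reindex f i, Function.comp_apply (f := P.curve), P.curve_eq_vertex hθ]
    _ ≤ 4 * δ + δ := (abs_sub_le _ _ _).trans
        (add_le_add (hosc.abs_sub_le right_mem_uIcc left_mem_uIcc) (hqp θ))
    _ = 5 * δ := by ring

theorem isVisitedStraightening_id (hQ : Q.numEdges = 0)
    (hqp : ∀ s, |Q.curve (f.1 s) - P.curve (g.1 s)| ≤ δ) :
    IsVisitedStraightening δ P Q id fun _ ↦ 0 := by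
  have hδ : 0 ≤ δ := (abs_nonneg _).trans (hqp 0)
  have hnoEdge : IsEmpty (Fin Q.numEdges) := hQ ▸ Fin.isEmpty
  have hvertex (i : Fin (Q.numEdges + 1)) : Q.vertex i = Q.vertex 0 := by
    congr
    ext
    lia
  have hzero : |Q.vertex 0 - P.vertex 0| ≤ δ := by
    have := hqp 0
    rwa [f.map_zero, g.map_zero, Q.curve_eq_vertex (k := 0) (by simp),
      P.curve_eq_vertex (k := 0) (by simp)] at this
  refine ⟨⟨strictMono_id, rfl, rfl, fun _ ↦ rfl, fun i j k hij ↦ by lia, hnoEdge.elim⟩,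
    hnoEdge.elim, ⟨monotone_const, fun i ↦ ?_⟩, frechetDist_le f g hqp⟩
  exact (hvertex i).symm ▸ hzero.trans (by linarith)

theorem exists_isVisitedStraightening (hqp : ∀ s, |Q.curve (f.1 s) - P.curve (g.1 s)| ≤ δ) :
    ∃ (l : ℕ) (t : Fin (l + 1) → Fin (Q.numEdges + 1)) (κ : Fin (l + 1) → Fin (P.numEdges + 1)),
      IsVisitedStraightening δ P Q t κ := by
  have hδ : 0 ≤ δ := (abs_nonneg _).trans (hqp 0)
  rcases eq_or_ne Q.numEdges 0 with hQ | hQ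
  · exact ⟨_, _, _, isVisitedStraightening_id hQ hqp⟩
  obtain ⟨l, t, ht, ht₀, ht₁, hT⟩ := exists_isTautChain hδ (p := P.curve ∘ g.1) hqp
  have hT₀ : f.lift (Q.param (t 0)) = 0 := by rw [ht₀, Q.param_zero, f.lift_zero]
  have hT₁ : f.lift (Q.param (t (Fin.last l))) = 1 := by rw [ht₁, Q.param_last hQ, f.lift_one]
  obtain ⟨κ, hκ⟩ := exists_isVisitingOrder_reindex hT hδ hqp hT₀ hT₁
  refine ⟨l, t, κ, ⟨ht, ht₀, ht₁, fun _ ↦ rfl, nondegenerate_reindex hT hδ hqp, fun k ↦ ?_⟩,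
    fun k s hs ↦ ?_, hκ, frechetDist_curve_le_of_shortcuts (P := Q.reindex t) hqp hT.strictMono
      hT₀ hT₁ (vertex_reindex f) hT.shortcut⟩
  · have := (shortcut_param hT k).frechetDist_subcurve_le hδ
    rwa [Q.curve_param, Q.curve_param] at this
  · have := (shortcut_param hT k).mem_uIcc hs
    rwa [Q.curve_param, Q.curve_param, ← segment_eq_uIcc] at this

namespace IsVisitedStraightening

theorem mono (h : IsVisitedStraightening δ P Q t κ) (hδ : δ ≤ ε) :
    IsVisitedStraightening ε P Q t κ where
  isSimplification := { h.isSimplification with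
    locality i := (h.isSimplification.locality i).trans hδ }
  isEdgeRangePreserving := h.isEdgeRangePreserving
  isVisitingOrder := ⟨h.isVisitingOrder.1, fun j ↦ (h.isVisitingOrder.2 j).trans (by gcongr)⟩
  frechetDist_le := h.frechetDist_le.trans hδ

theorem of_forall_gt (h : ∀ ε, δ < ε → IsVisitedStraightening ε P Q t κ) :
    IsVisitedStraightening δ P Q t κ := by
  have h' := h (δ + 1) (lt_add_one δ)
  refine ⟨{ h'.isSimplification with locality i := ?_ }, h'.isEdgeRangePreserving,
    ⟨h'.isVisitingOrder.1, fun j ↦ ?_⟩, ?_⟩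
  · exact le_of_forall_gt_imp_ge_of_dense fun ε hε ↦ (h ε hε).isSimplification.locality i
  · refine (div_le_iff₀' (by norm_num)).1 (le_of_forall_gt_imp_ge_of_dense fun ε hε ↦ ?_)
    exact (div_le_iff₀' (by norm_num)).2 ((h ε hε).isVisitingOrder.2 j)
  · exact le_of_forall_gt_imp_ge_of_dense fun ε hε ↦ (h ε hε).frechetDist_le

theorem length_lt (h : IsVisitedStraightening δ P Q t κ) : l < Q.numEdges + 1 := by
  simpa using Fintype.card_le_of_injective t h.isSimplification.strictMono.injective

end IsVisitedStraightening

end PolygonalCurve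

open PolygonalCurve in
theorem mainTheorem12_general (P Q : PolygonalCurve) (δ : ℝ)
    (h : frechetDist Q.curve P.curve ≤ δ) :
    ∃ Q' : PolygonalCurve, IsStraightening δ Q Q' ∧
      (∃ κ : Fin (Q'.numEdges + 1) → Fin (P.numEdges + 1), IsVisitingOrder (5 * δ) Q' P κ) ∧
      frechetDist Q'.curve P.curve ≤ δ := by
  let X := Σ l : Fin (Q.numEdges + 1), (Fin ((l : ℕ) + 1) → Fin (Q.numEdges + 1)) ×
    (Fin ((l : ℕ) + 1) → Fin (P.numEdges + 1))
  obtain ⟨⟨l, t, κ⟩, hx⟩ := exists_forall_gt_of_finite (X := X) (a := δ)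
    (p := fun x ε ↦ IsVisitedStraightening ε P Q x.2.1 x.2.2)
    (fun x ε ε' hε hx ↦ hx.mono hε) (fun ε hε ↦ by
      obtain ⟨f, g, hfg⟩ := exists_reparam_of_frechetDist_lt (h.trans_lt hε)
      obtain ⟨l, t, κ, hκ⟩ := exists_isVisitedStraightening hfg
      exact ⟨⟨⟨l, hκ.length_lt⟩, t, κ⟩, hκ⟩)
  have hgood := IsVisitedStraightening.of_forall_gt hx
  exact ⟨Q.reindex t, ⟨t, hgood.isSimplification, hgood.isEdgeRangePreserving⟩,
    ⟨κ, hgood.isVisitingOrder⟩, hgood.frechetDist_le⟩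

theorem mainTheorem12 (P Q : PolygonalCurve) (δ : ℝ)
    (h : frechetDist Q.curve P.curve ≤ δ) :
    ∃ Q' : PolygonalCurve, PolygonalCurve.IsStraightening δ Q Q' ∧
      (∃ κ : Fin (Q'.numEdges + 1) → Fin (P.numEdges + 1),
        PolygonalCurve.IsVisitingOrder (11 * δ) Q' P κ) ∧
      frechetDist Q'.curve P.curve ≤ δ := by
  obtain ⟨Q', hQ', ⟨κ, hκ⟩, hP⟩ := mainTheorem12_general P Q δ h
  have hδ : 0 ≤ 5 * δ := (abs_nonneg _).trans (hκ.2 0)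
  exact ⟨Q', hQ', ⟨κ, hκ.1, fun j ↦ (hκ.2 j).trans (by linarith)⟩, hP⟩
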